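/- A **(left) global action** on a set $X$ consists of an index set $\Phi$ with a reflexive relation $\le$ (not necessarily transitive), subsets $X_\alpha\subseteq X$ with $\bigcup_{\alpha\in\Phi} X_\alpha=X$, groups $G_\alpha$ acting on $X_\alpha$ ($\alpha\in\Phi$), and for $\alpha\le\beta$ a group homomorphism $G_{\alpha\le\beta}:G_\alpha\to G_\beta$, with $G_{\alpha\le\alpha}=\mathrm{id}$, such that whenever $\alpha\le\beta$, $g\in G_\alpha$ and $x\in X_\alpha\cap X_\beta$, one has $gx\in X_\alpha\cap X_\beta$ and $G_{\alpha\le\beta}(g)\,x=gx$. A **local frame** in $X$ is a finite set $\{x_0,\dots,x_n\}$ (repetitions in the list allowed) for which there is an $\alpha\in\Phi$ such that $x_0,\dots,x_n\in X_\alpha$ and for each $i$ some $g_i\in G_\alpha$ satisfies $g_ix_0=x_i$. A **morphism** of global actions is a function which maps local frames to local frames. The **line action** $L$ is the global action on $\mathbb Z$ with index set $\mathbb Z\cup\{*\}$, $L_n=\{n,n+1\}$ acted on by the group of order two exchanging $n$ and $n+1$, $L_*=\mathbb Z$ acted on by the trivial group, and with $*\le n$ $(n\in\mathbb Z)$ as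 the only relations besides reflexivity. The **product** of global actions $\{G_\alpha\curvearrowright X_\alpha\}_{\alpha\in\Phi}$ and $\{H_\beta\curvearrowright Y_\beta\}_{\beta\in\Psi}$ is the global action on $X\times Y$ with index set $\Phi\times\Psi$, componentwise relation and structure homomorphisms, and local actions $G_\alpha\times H_\beta\curvearrowright X_\alpha\times Y_\beta$. A **path** in $X$ is a morphism $\omega:L\to X$ that is constant on all sufficiently small integers, with value $\mathrm{init}(\omega)$, and constant on all sufficiently large integers, with value $\mathrm{term}(\omega)$. $X$ is **path connected** if for all $x,y\in X$ there is a path $\omega$ in $X$ with $\mathrm{init}(\omega)=x$ and $\mathrm{term}(\omega)=y$. A **loop at $x$** is a path $\omega$ with $\mathrm{init}(\omega)=\mathrm{term}(\omega)=x$. Two loops $\omega,\omega'$ at $x$ are equivalent if there is a morphism $H:L\times L\to X$ such that $H(\cdot,n)$ is a loop at $x$ for every $n\in\mathbb Z$, $H(\cdot,n)=\omega$ for all sufficiently small $n$, and $H(\cdot,n)=\omega'$ for all sufficiently large $n$. This is an equivalence relation; $\pi_1(X,x)$ denotes the set of equivalence classes $[\omega]$ (the underlying set of the fundamental group). A morphism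 $f:X\to Y$ with $f(x)=y$ induces a map $f_*:\pi_1(X,x)\to\pi_1(Y,y)$, $[\omega]\mapsto[f\omega]$. A morphism $p:Y\to X$ is a **covering morphism** if for every local frame $\{x_0,\dots,x_n\}$ in $X$ and every $y_0\in p^{-1}(x_0)$ there are unique $y_1,\dots,y_n\in Y$ such that $\{y_0,y_1,\dots,y_n\}$ is a local frame in $Y$ and $p(y_i)=x_i$ for all $i\in\{1,\dots,n\}$. **Theorem 4.7 (Lifting Criterion).** Let $X,Y,Z$ be global actions with base points $x_0\in X$, $y_0\in Y$, $z_0\in Z$. Let $p:Y\to X$ be a covering morphism with $p(y_0)=x_0$ and $f:Z\to X$ a morphism with $f(z_0)=x_0$, and suppose that $Z$ is path connected. Then there is a morphism $\tilde f:Z\to Y$ with $p\tilde f=f$ and $\tilde f(z_0)=y_0$ if and only if $f_*(\pi_1(Z,z_0))\subseteq p_*(\pi_1(Y,y_0))$. -/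

import Mathlib

universe u v w u' v' w'

/-- A (left) global action on a set `X`. -/
structure GlobalAction (X : Type u) where
  /-- the indexing set -/
  Idx : Type v
  /-- the relation on the indexing set (reflexive, not necessarily transitive) -/
  le : Idx → Idx → Prop
  le_refl : ∀ α, le α α
  /-- the local groups -/
  Grp : Idx → Type w
  [group : ∀ α, Group (Grp α)]
  /-- the local sets -/
  loc : Idx → Set X
  /-- the local actions -/
  [action : ∀ α, MulAction (Grp α) (loc α)]
  /-- the local sets cover `X` -/
  cover : ∀ x, ∃ α, x ∈ loc α
  /-- if `α ≤ β` then `loc α ∩ loc β` is stable under the local group at `α` -/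
  stable : ∀ {α β}, le α β → ∀ (g : Grp α) (x : loc α), (x : X) ∈ loc β →
    ((g • x : loc α) : X) ∈ loc β
  /-- the structure homomorphisms -/
  hom : ∀ {α β}, le α β → Grp α →* Grp β
  hom_refl : ∀ α, hom (le_refl α) = MonoidHom.id (Grp α)
  /-- the structure homomorphism at `α ≤ β`, together with the inclusion
  of `loc α ∩ loc β` into `loc β`, is a morphism of group actions -/
  hom_smul : ∀ {α β} (h : le α β) (g : Grp α) (x : loc α) (hx : (x : X) ∈ loc β),
    ((hom h g • (⟨x, hx⟩ : loc β) : loc β) : X) = ((g • x : loc α) : X)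

namespace GlobalAction

attribute [instance] GlobalAction.group GlobalAction.action

variable {X : Type u} {Y : Type u'}

/-- The finite set `{x 0, ..., x n}` (repetitions allowed) is a local frame at `α`. -/
def IsFrameAt (A : GlobalAction.{u, v, w} X) (α : A.Idx) {n : ℕ} (x : Fin (n + 1) → X) : Prop :=
  ∃ hx : ∀ i, x i ∈ A.loc α, ∀ i, ∃ g : A.Grp α, g • (⟨x 0, hx 0⟩ : A.loc α) = ⟨x i, hx i⟩

/-- The finite set `{x 0, ..., x n}` (repetitions allowed) is a local frame. -/
def IsFrame (A : GlobalAction.{u, v, w} X) {n : ℕ} (x : Fin (n + 1) → X) : Prop :=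
  ∃ α, A.IsFrameAt α x

/-- Morphisms of global actions: functions that preserve local frames. -/
structure Hom (A : GlobalAction.{u, v, w} X) (B : GlobalAction.{u', v', w'} Y) where
  toFun : X → Y
  map_frame : ∀ {n : ℕ} (x : Fin (n + 1) → X), A.IsFrame x → B.IsFrame fun i => toFun (x i)

instance (A : GlobalAction.{u, v, w} X) (B : GlobalAction.{u', v', w'} Y) :
    CoeFun (Hom A B) fun _ => X → Y := ⟨Hom.toFun⟩

/-- The product of two global actions. -/
def prod (A : GlobalAction.{u, v, w} X) (B : GlobalAction.{u', v', w'} Y) :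
    GlobalAction (X × Y) where
  Idx := A.Idx × B.Idx
  le i j := A.le i.1 j.1 ∧ B.le i.2 j.2
  le_refl i := ⟨A.le_refl i.1, B.le_refl i.2⟩
  Grp i := A.Grp i.1 × B.Grp i.2
  group _ := inferInstance
  loc i := A.loc i.1 ×ˢ B.loc i.2
  action i :=
    { smul := fun g z =>
        ⟨(((g.1 • ⟨z.1.1, z.2.1⟩ : A.loc i.1) : X), ((g.2 • ⟨z.1.2, z.2.2⟩ : B.loc i.2) : Y)),
          ⟨Subtype.prop _, Subtype.prop _⟩⟩
      one_smul := fun z => Subtype.ext <| Prod.ext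
        (congrArg Subtype.val (one_smul (A.Grp i.1) (⟨z.1.1, z.2.1⟩ : A.loc i.1)))
        (congrArg Subtype.val (one_smul (B.Grp i.2) (⟨z.1.2, z.2.2⟩ : B.loc i.2)))
      mul_smul := fun g h z => Subtype.ext <| Prod.ext
        (congrArg Subtype.val (mul_smul g.1 h.1 (⟨z.1.1, z.2.1⟩ : A.loc i.1)))
        (congrArg Subtype.val (mul_smul g.2 h.2 (⟨z.1.2, z.2.2⟩ : B.loc i.2))) }
  cover z := by
    obtain ⟨α, hα⟩ := A.cover z.1
    obtain ⟨β, hβ⟩ := B.cover z.2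
    exact ⟨(α, β), hα, hβ⟩
  stable h g z hz :=
    ⟨A.stable h.1 g.1 ⟨z.1.1, z.2.1⟩ hz.1, B.stable h.2 g.2 ⟨z.1.2, z.2.2⟩ hz.2⟩
  hom h := (A.hom h.1).prodMap (B.hom h.2)
  hom_refl i := by
    ext g <;> simp [A.hom_refl, B.hom_refl]
  hom_smul h g z hz := Prod.ext
    (A.hom_smul h.1 g.1 ⟨z.1.1, z.2.1⟩ hz.1) (B.hom_smul h.2 g.2 ⟨z.1.2, z.2.2⟩ hz.2)

/-! The line action on `ℤ`. The index `none` stands for the extra index `*`. -/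

/-- The local sets of the line action: `ℤ` at `*`, and `{n, n + 1}` at `n`. -/
def lineLoc : Option ℤ → Set ℤ
  | none => Set.univ
  | some n => {n, n + 1}

/-- The local groups of the line action: trivial at `*`, and at `n` the group of order two
of all permutations of `{n, n + 1}`. -/
def lineGrp : Option ℤ → Type
  | none => Unit
  | some n => Equiv.Perm (lineLoc (some n))

instance lineGroup : ∀ i, Group (lineGrp i)
  | none => inferInstanceAs (Group Unit)
  | some n => inferInstanceAs (Group (Equiv.Perm (lineLoc (some n))))

instance lineAction : ∀ i, MulAction (lineGrp i) (lineLoc i)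
  | none =>
    { smul := fun _ x => x
      one_smul := fun _ => rfl
      mul_smul := fun _ _ _ => rfl }
  | some n => inferInstanceAs (MulAction (Equiv.Perm (lineLoc (some n))) (lineLoc (some n)))

/-- The line action on `ℤ`. Apart from reflexivity, the only relations are `* ≤ n`. -/
def line : GlobalAction ℤ where
  Idx := Option ℤ
  le i j := i = j ∨ i = none
  le_refl _ := Or.inl rfl
  Grp := lineGrp
  loc := lineLoc
  cover _ := ⟨none, Set.mem_univ _⟩
  stable := by
    rintro i j (rfl | rfl) g x hx
    · exact Subtype.prop _
    · exact hx
  hom {i j} _ := if h : i = j then h ▸ MonoidHom.id (lineGrp i) else 1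
  hom_refl _ := by simp
  hom_smul := by
    rintro i j h g x hx
    by_cases hij : i = j
    · subst hij
      simp
    · obtain rfl : i = none := h.resolve_left hij
      rw [dif_neg hij, MonoidHom.one_apply, one_smul]
      rfl

/-- A path: a morphism from the line action which stabilizes on the left and on the right. -/
structure Path (A : GlobalAction.{u, v, w} X) extends Hom line A where
  stab_left : ∃ k, ∀ n ≤ k, toFun n = toFun k
  stab_right : ∃ k, ∀ n, k ≤ n → toFun n = toFun k

instance (A : GlobalAction.{u, v, w} X) : CoeFun (Path A) fun _ => ℤ → X :=
  ⟨fun ω => ω.toFun⟩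

/-- The initial point of a path: its constant value on all sufficiently small integers
(see `Path.init_eq_iff`). -/
noncomputable def Path.init {A : GlobalAction.{u, v, w} X} (ω : Path A) : X :=
  ω ω.stab_left.choose

/-- The terminal point of a path: its constant value on all sufficiently large integers
(see `Path.term_eq_iff`). -/
noncomputable def Path.term {A : GlobalAction.{u, v, w} X} (ω : Path A) : X :=
  ω ω.stab_right.choose

theorem Path.init_eq_iff {A : GlobalAction.{u, v, w} X} (ω : Path A) (x : X) :
    ω.init = x ↔ ∃ k, ∀ n ≤ k, ω n = x := by
  have h := ω.stab_left.choose_spec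
  constructor
  · rintro rfl
    exact ⟨_, h⟩
  · rintro ⟨k, hk⟩
    rw [← hk _ (min_le_right ω.stab_left.choose k)]
    exact (h _ (min_le_left _ _)).symm

theorem Path.term_eq_iff {A : GlobalAction.{u, v, w} X} (ω : Path A) (x : X) :
    ω.term = x ↔ ∃ k, ∀ n, k ≤ n → ω n = x := by
  have h := ω.stab_right.choose_spec
  constructor
  · rintro rfl
    exact ⟨_, h⟩
  · rintro ⟨k, hk⟩
    rw [← hk _ (le_max_right ω.stab_right.choose k)]
    exact (h _ (le_max_left _ _)).symm

/-- A global action is path connected if any two points are joined by a path. -/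
def PathConnected (A : GlobalAction.{u, v, w} X) : Prop :=
  ∀ x y : X, ∃ ω : Path A, ω.init = x ∧ ω.term = y

/-- The loops at `x`. -/
structure Loop (A : GlobalAction.{u, v, w} X) (x : X) extends Path A where
  init_eq : toPath.init = x
  term_eq : toPath.term = x

instance (A : GlobalAction.{u, v, w} X) (x : X) : CoeFun (Loop A x) fun _ => ℤ → X :=
  ⟨fun ω => ω.toFun⟩

/-- Two loops at `x` are end point stable homotopic: there is a morphism `H` from the product of
two line actions which in the second variable stabilizes at `ω` on the left and at `ω'`
on the right, and all of whose rows `H (·, n)` are loops at `x`. -/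
def Loop.Homotopic {A : GlobalAction.{u, v, w} X} {x : X} (ω ω' : Loop A x) : Prop :=
  ∃ H : Hom (line.prod line) A,
    (∃ k, ∀ n ≤ k, ∀ m, H (m, n) = ω m) ∧
    (∃ k, ∀ n, k ≤ n → ∀ m, H (m, n) = ω' m) ∧
    ∀ n, ∃ l : Loop A x, ∀ m, H (m, n) = l m

/-- The local frames of the line action are the families in some `{k, k + 1}`. -/
theorem line_isFrame_iff {n : ℕ} (x : Fin (n + 1) → ℤ) :
    line.IsFrame x ↔ ∃ k, ∀ i, x i = k ∨ x i = k + 1 := by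
  constructor
  · rintro ⟨_ | k, hx, hg⟩
    · refine ⟨x 0, fun i => Or.inl ?_⟩
      obtain ⟨g, hg⟩ := hg i
      exact (congrArg Subtype.val hg).symm
    · exact ⟨k, hx⟩
  · rintro ⟨k, hk⟩
    exact ⟨some k, hk, fun i =>
      ⟨Equiv.swap (α := lineLoc (some k)) ⟨x 0, hk 0⟩ ⟨x i, hk i⟩, Equiv.swap_apply_left _ _⟩⟩

/-- A family is a local frame of a product if and only if both its projections are. -/
theorem prod_isFrame_iff (A : GlobalAction.{u, v, w} X) (B : GlobalAction.{u', v', w'} Y)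
    {n : ℕ} (z : Fin (n + 1) → X × Y) :
    (A.prod B).IsFrame z ↔ A.IsFrame (fun i => (z i).1) ∧ B.IsFrame (fun i => (z i).2) := by
  constructor
  · rintro ⟨⟨α, β⟩, hz, hg⟩
    refine ⟨⟨α, fun i => (hz i).1, fun i => ?_⟩, ⟨β, fun i => (hz i).2, fun i => ?_⟩⟩
    · obtain ⟨g, hg⟩ := hg i
      exact ⟨g.1, Subtype.ext (congrArg (fun t => t.1.1) hg)⟩
    · obtain ⟨g, hg⟩ := hg i
      exact ⟨g.2, Subtype.ext (congrArg (fun t => t.1.2) hg)⟩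
  · rintro ⟨⟨α, hx, hg⟩, ⟨β, hy, hh⟩⟩
    refine ⟨(α, β), fun i => ⟨hx i, hy i⟩, fun i => ?_⟩
    obtain ⟨g, hg⟩ := hg i
    obtain ⟨h, hh⟩ := hh i
    exact ⟨(g, h), Subtype.ext (Prod.ext (congrArg Subtype.val hg) (congrArg Subtype.val hh))⟩

/-- The first projection of a product is a morphism. -/
def homFst (A : GlobalAction.{u, v, w} X) (B : GlobalAction.{u', v', w'} Y) :
    Hom (A.prod B) A :=
  ⟨Prod.fst, fun z hz => ((prod_isFrame_iff A B z).1 hz).1⟩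

/-- Composition of morphisms. -/
def Hom.comp {Z : Type*} {A : GlobalAction.{u, v, w} X} {B : GlobalAction.{u', v', w'} Y}
    {C : GlobalAction Z} (g : Hom B C) (f : Hom A B) : Hom A C :=
  ⟨fun x => g (f x), fun x hx => g.map_frame _ (f.map_frame x hx)⟩

theorem Loop.Homotopic.refl {A : GlobalAction.{u, v, w} X} {x : X} (ω : Loop A x) :
    ω.Homotopic ω :=
  ⟨ω.toHom.comp (homFst line line), ⟨0, fun _ _ _ => rfl⟩, ⟨0, fun _ _ _ => rfl⟩,
    fun _ => ⟨ω, fun _ => rfl⟩⟩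

theorem Loop.Homotopic.symm {A : GlobalAction.{u, v, w} X} {x : X} {ω ω' : Loop A x}
    (h : ω.Homotopic ω') : ω'.Homotopic ω := by
  obtain ⟨H, ⟨a, ha⟩, ⟨b, hb⟩, hl⟩ := h
  refine ⟨⟨fun z => H (z.1, -z.2), fun z hz => H.map_frame (fun i => ((z i).1, -(z i).2)) ?_⟩,
    ⟨-b, fun n hn m => hb (-n) (by lia) m⟩, ⟨-a, fun n hn m => ha (-n) (by lia) m⟩,
    fun n => hl (-n)⟩
  rw [prod_isFrame_iff, line_isFrame_iff, line_isFrame_iff] at hz ⊢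
  obtain ⟨h1, k, hk⟩ := hz
  exact ⟨h1, -k - 1, fun i => by have := hk i; lia⟩

theorem Loop.Homotopic.trans {A : GlobalAction.{u, v, w} X} {x : X} {ω₁ ω₂ ω₃ : Loop A x}
    (h : ω₁.Homotopic ω₂) (h' : ω₂.Homotopic ω₃) : ω₁.Homotopic ω₃ := by
  obtain ⟨H, ⟨a, ha⟩, ⟨b, hb⟩, hl⟩ := h
  obtain ⟨H', ⟨c, hc⟩, ⟨d, hd⟩, hl'⟩ := h'
  have key : ∀ z : ℤ × ℤ, b ≤ z.2 →
      (if z.2 ≤ b then H z else H' (z.1, z.2 - b + c)) = H' (z.1, z.2 - b + c) := by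
    rintro ⟨m, n⟩ hn
    split_ifs with h
    · obtain rfl : n = b := le_antisymm h hn
      rw [hb n le_rfl, hc _ (by lia)]
    · rfl
  refine ⟨⟨fun z => if z.2 ≤ b then H z else H' (z.1, z.2 - b + c), fun z hz => ?_⟩,
    ⟨min a b, fun n hn m => ?_⟩, ⟨max (b + 1) (d + b - c), fun n hn m => ?_⟩, fun n => ?_⟩
  · have hz' := hz
    rw [prod_isFrame_iff, line_isFrame_iff, line_isFrame_iff] at hz'
    obtain ⟨h1, k, hk⟩ := hz'
    by_cases hkb : k + 1 ≤ b
    · have : ∀ i, (z i).2 ≤ b := fun i => by have := hk i; lia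
      simp only [this, if_true]
      exact H.map_frame z hz
    · have : ∀ i, b ≤ (z i).2 := fun i => by have := hk i; lia
      simp only [key _ (this _)]
      refine H'.map_frame (fun i => ((z i).1, (z i).2 - b + c)) ?_
      rw [prod_isFrame_iff, line_isFrame_iff, line_isFrame_iff]
      exact ⟨h1, k - b + c, fun i => by have := hk i; lia⟩
  · exact (if_pos (by simp at hn; lia)).trans (ha n (by simp at hn; lia) m)
  · exact (if_neg (by simp at hn; lia)).trans (hd (n - b + c) (by simp at hn; lia) m)
  · by_cases h : n ≤ b
    · simpa only [h, if_true] using hl n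
    · simpa only [h, if_false] using hl' (n - b + c)

/-- End point stable homotopy as an equivalence relation on the loops at `x`. -/
def loopSetoid (A : GlobalAction.{u, v, w} X) (x : X) : Setoid (Loop A x) where
  r := Loop.Homotopic
  iseqv := ⟨Loop.Homotopic.refl, Loop.Homotopic.symm, Loop.Homotopic.trans⟩

/-- The set underlying the fundamental group of a global action at a base point: the
end point stable homotopy classes of loops at the base point. -/
def Pi1 (A : GlobalAction.{u, v, w} X) (x : X) := Quotient (loopSetoid A x)

/-- The image of a path under a morphism. -/
def Path.map {A : GlobalAction.{u, v, w} X} {B : GlobalAction.{u', v', w'} Y} (f : Hom A B)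
    (ω : Path A) : Path B where
  toHom := f.comp ω.toHom
  stab_left := ω.stab_left.imp fun _ hk n hn => congrArg f (hk n hn)
  stab_right := ω.stab_right.imp fun _ hk n hn => congrArg f (hk n hn)

/-- The image of a loop at `x` under a morphism `f` with `f x = y`, a loop at `y`. -/
def Loop.map {A : GlobalAction.{u, v, w} X} {B : GlobalAction.{u', v', w'} Y} (f : Hom A B)
    {x : X} {y : Y} (h : f x = y) (ω : Loop A x) : Loop B y where
  toPath := ω.toPath.map f
  init_eq := (Path.init_eq_iff _ _).2 <|
    ((Path.init_eq_iff _ _).1 ω.init_eq).imp fun _ hk n hn => (congrArg f (hk n hn)).trans h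
  term_eq := (Path.term_eq_iff _ _).2 <|
    ((Path.term_eq_iff _ _).1 ω.term_eq).imp fun _ hk n hn => (congrArg f (hk n hn)).trans h

/-- The map `[ω] ↦ [f ω]` induced on fundamental groups by a morphism `f` with `f x = y`. -/
def Pi1.map {A : GlobalAction.{u, v, w} X} {B : GlobalAction.{u', v', w'} Y} (f : Hom A B)
    {x : X} {y : Y} (h : f x = y) : Pi1 A x → Pi1 B y :=
  Quotient.map (sa := loopSetoid A x) (sb := loopSetoid B y) (Loop.map f h) <| by
    rintro ω ω' ⟨H, ⟨a, ha⟩, ⟨b, hb⟩, hl⟩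
    exact ⟨f.comp H, ⟨a, fun n hn m => congrArg f (ha n hn m)⟩,
      ⟨b, fun n hn m => congrArg f (hb n hn m)⟩,
      fun n => (hl n).elim fun l hl => ⟨l.map f h, fun m => congrArg f (hl m)⟩⟩

/-- A morphism `p` is a covering morphism if every local frame `x 0, ..., x n` of the target has,
for each `y₀` over `x 0`, a unique lift to a local frame starting at `y₀`. -/
def IsCovering {A : GlobalAction.{u, v, w} X} {B : GlobalAction.{u', v', w'} Y}
    (p : Hom B A) : Prop :=
  ∀ (n : ℕ) (x : Fin (n + 1) → X), A.IsFrame x → ∀ y₀ : Y, p y₀ = x 0 →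
    ∃! y : Fin (n + 1) → Y, B.IsFrame y ∧ y 0 = y₀ ∧ ∀ i, p (y i) = x i

end GlobalAction

/-!
The lift `F` is found by describing its graph. `JointlyReachable p f z₀ y₀ z y` says that some path
in `Z` from `z₀` to `z` has an image under `f` with a lift to `Y` from `y₀` to `y`; this relation
has to be the graph of `F`.

* It relates every `z` to some `y`, since `Z` is path connected and paths can be lifted one step at
  a time (`IsCovering.exists_jointlyReachable`).
* It relates `z` to only one `y` (`IsCovering.jointlyReachable_unique`). Two paths in `Z` from `z₀`
  to `z` form a loop `l` at `z₀`. By the hypothesis on fundamental groups `f l` is homotopic to the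
  image of a loop at `y₀`, and by homotopy lifting (`IsCovering.lift_of_homotopic`) `f l` itself
  lifts to a loop at `y₀`. The lifts of the two halves are determined by their values at the ends,
  so they are the two halves of that loop, and they meet in the middle.
* The resulting function is a morphism: a path to the first point of a local frame can be prolonged
  by one step to each of the other points, so the values at these points are those of the unique
  lift of the frame.

Lifting a homotopy needs no lift of the whole square grid: a lift of one row is transported to the
next row pointwise, and the four corners of each unit square form a local frame, whose unique lift
shows that the transported row is again a morphism.
-/

namespace GlobalAction

variable {X : Type u} {Y : Type u'} {Z : Type*}
variable {A : GlobalAction.{u, v, w} X} {B : GlobalAction.{u', v', w'} Y} {C : GlobalAction Z}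

/-! ### Local frames and steps -/

/-- The points of a local frame may be permuted, repeated and omitted. -/
theorem IsFrame.reindex {n m : ℕ} {x : Fin (n + 1) → X} (hx : A.IsFrame x)
    (σ : Fin (m + 1) → Fin (n + 1)) : A.IsFrame fun i => x (σ i) := by
  obtain ⟨α, h, hg⟩ := hx
  choose g hg using hg
  exact ⟨α, fun i => h (σ i), fun i => ⟨g (σ i) * (g (σ 0))⁻¹, by
    rw [mul_smul, ← hg (σ 0), inv_smul_smul, hg]⟩⟩

/-- `x` and `y` are the points of a local frame. Morphisms from the line action are the sequences
whose consecutive points are related in this way. -/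
def Step (A : GlobalAction.{u, v, w} X) (x y : X) : Prop :=
  A.IsFrame (n := 1) ![x, y]

theorem IsFrame.step {n : ℕ} {x : Fin (n + 1) → X} (hx : A.IsFrame x) (i j : Fin (n + 1)) :
    A.Step (x i) (x j) := by
  have : ![x i, x j] = fun k => x (![i, j] k) := funext fun k => by fin_cases k <;> rfl
  rw [Step, this]
  exact hx.reindex (m := 1) ![i, j]

theorem Step.symm {x y : X} (h : A.Step x y) : A.Step y x :=
  IsFrame.step h 1 0

theorem Step.refl (A : GlobalAction.{u, v, w} X) (x : X) : A.Step x x := by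
  obtain ⟨α, hα⟩ := A.cover x
  exact IsFrame.step (n := 0) (x := fun _ => x) ⟨α, fun _ => hα, fun _ => ⟨1, one_smul _ _⟩⟩ 0 0

theorem Step.map (f : Hom A B) {x y : X} (h : A.Step x y) : B.Step (f x) (f y) :=
  (f.map_frame _ h).step 0 1

theorem line_step (n : ℤ) : line.Step n (n + 1) :=
  (line_isFrame_iff _).2 ⟨n, fun i => by fin_cases i <;> simp⟩

/-- A sequence of steps is a morphism from the line action. -/
def Hom.ofStep (ω : ℤ → X) (h : ∀ n, A.Step (ω n) (ω (n + 1))) : Hom line A where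
  toFun := ω
  map_frame {n} x hx := by
    obtain ⟨k, hk⟩ := (line_isFrame_iff x).1 hx
    convert IsFrame.reindex (h k) (m := n) (fun i => if x i = k then 0 else 1) using 2 with i
    rcases hk i with hi | hi <;> simp [hi]

theorem Loop.exists_stable {x : X} (l : Loop A x) :
    (∃ a, ∀ n ≤ a, l n = x) ∧ ∃ b, ∀ n, b ≤ n → l n = x :=
  ⟨(Path.init_eq_iff _ _).1 l.init_eq, (Path.term_eq_iff _ _).1 l.term_eq⟩

/-- A sequence of steps that is eventually `x` on both sides is a loop at `x`. -/
def Loop.ofStep {x : X} (ω : ℤ → X) (h : ∀ n, A.Step (ω n) (ω (n + 1)))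
    (hl : ∃ a, ∀ n ≤ a, ω n = x) (hr : ∃ b, ∀ n, b ≤ n → ω n = x) : Loop A x where
  toHom := Hom.ofStep ω h
  stab_left := hl.imp fun a ha n hn => (ha n hn).trans (ha a le_rfl).symm
  stab_right := hr.imp fun b hb n hn => (hb n hn).trans (hb b le_rfl).symm
  init_eq := (Path.init_eq_iff _ _).2 hl
  term_eq := (Path.term_eq_iff _ _).2 hr

/-! ### Unique lifting of steps, paths and homotopies -/

theorem IsCovering.step_unique {p : Hom B A} (hp : IsCovering p) {y y₁ y₂ : Y}
    (h₁ : B.Step y y₁) (h₂ : B.Step y y₂) (h : p y₁ = p y₂) : y₁ = y₂ := by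
  refine congrFun ((hp 1 ![p y, p y₁] (h₁.map p) y rfl).unique
    (y₁ := ![y, y₁]) (y₂ := ![y, y₂]) ⟨h₁, rfl, ?_⟩ ⟨h₂, rfl, ?_⟩) 1
  · intro i
    fin_cases i <;> rfl
  · intro i
    fin_cases i
    · rfl
    · exact h.symm

theorem IsCovering.exists_step {p : Hom B A} (hp : IsCovering p) {y : Y} {x : X}
    (h : A.Step (p y) x) : ∃ y', B.Step y y' ∧ p y' = x := by
  obtain ⟨s, ⟨hs, h0, hps⟩, -⟩ := hp 1 _ h y rfl
  exact ⟨s 1, h0 ▸ hs.step 0 1, hps 1⟩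

/-- A family over a local frame is the unique lift of that frame as soon as each of its points
is a step away from the first one. -/
theorem IsCovering.isFrame_of_step {p : Hom B A} (hp : IsCovering p) {n : ℕ}
    {y : Fin (n + 1) → Y} (hx : A.IsFrame fun i => p (y i)) (hy : ∀ i, B.Step (y 0) (y i)) :
    B.IsFrame y := by
  obtain ⟨s, ⟨hs, h0, hps⟩, -⟩ := hp n _ hx (y 0) rfl
  have : s = y := funext fun i => hp.step_unique (h0 ▸ hs.step 0 i) (hy i) (hps i)
  exact this ▸ hs

theorem IsCovering.lift_unique {p : Hom B A} (hp : IsCovering p) {g h : ℤ → Y} {a b : ℤ}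
    (hab : a ≤ b) (hg : ∀ n < b, B.Step (g n) (g (n + 1))) (hh : ∀ n < b, B.Step (h n) (h (n + 1)))
    (hpgh : ∀ n ≤ b, p (g n) = p (h n)) (ha : g a = h a) : g b = h b := by
  suffices H : ∀ n, a ≤ n → n ≤ b → g n = h n from H b hab le_rfl
  intro n hn
  induction n, hn using Int.leInduction with
  | base => exact fun _ => ha
  | succ n hn ih =>
    intro hb
    refine hp.step_unique (hg n (by lia)) ?_ (hpgh _ hb)
    rw [ih (by lia)]
    exact hh n (by lia)

/-- `ω` has a lift along `p` that is a loop at `y₀`. -/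
def LiftsToLoop (p : Hom B A) (y₀ : Y) (ω : ℤ → X) : Prop :=
  ∃ l : Loop B y₀, ∀ n, p (l n) = ω n

/-- Transport of a closed lift to the next row of a homotopy. -/
theorem IsCovering.liftsToLoop_succ {p : Hom B A} (hp : IsCovering p) {x₀ : X} {y₀ : Y}
    (H : Hom (line.prod line) A) (n : ℤ) (hn : ∃ l : Loop A x₀, ∀ m, H (m, n) = l m)
    (hn' : ∃ l : Loop A x₀, ∀ m, H (m, n + 1) = l m)
    (h : LiftsToLoop p y₀ fun m => H (m, n)) : LiftsToLoop p y₀ fun m => H (m, n + 1) := by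
  obtain ⟨g, hg⟩ := h
  replace hg (m : ℤ) : p (g m) = H (m, n) := hg m
  have vert (m : ℤ) : A.Step (p (g m)) (H (m, n + 1)) := by
    rw [hg]
    refine Step.map H (x := (m, n)) (y := (m, n + 1)) ((prod_isFrame_iff _ _ _).2 ?_)
    rw [line_isFrame_iff, line_isFrame_iff]
    exact ⟨⟨m, fun i => by fin_cases i <;> simp⟩, ⟨n, fun i => by fin_cases i <;> simp⟩⟩
  choose g' hgg' hpg' using fun m => hp.exists_step (vert m)
  have horiz (k : ℤ) : B.Step (g' k) (g' (k + 1)) := by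
    -- the four corners of a unit square
    have hsq : A.IsFrame (n := 3) fun i =>
        H ((![(k, n), (k + 1, n), (k, n + 1), (k + 1, n + 1)] : Fin 4 → ℤ × ℤ) i) := by
      refine H.map_frame _ ((prod_isFrame_iff _ _ _).2 ?_)
      rw [line_isFrame_iff, line_isFrame_iff]
      exact ⟨⟨k, fun i => by fin_cases i <;> simp⟩, ⟨n, fun i => by fin_cases i <;> simp⟩⟩
    obtain ⟨s, ⟨hs, h0, hps⟩, -⟩ := hp 3 _ hsq (g k) (hg k)
    have h1 : s 1 = g (k + 1) :=
      hp.step_unique (h0 ▸ hs.step 0 1) ((line_step k).map g.toHom) ((hps 1).trans (hg _).symm)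
    have h2 : s 2 = g' k :=
      hp.step_unique (h0 ▸ hs.step 0 2) (hgg' k) ((hps 2).trans (hpg' _).symm)
    have h3 : s 3 = g' (k + 1) :=
      hp.step_unique (h1 ▸ hs.step 1 3) (hgg' (k + 1)) ((hps 3).trans (hpg' _).symm)
    exact h2 ▸ h3 ▸ hs.step 2 3
  obtain ⟨l, hl⟩ := hn
  obtain ⟨l', hl'⟩ := hn'
  -- where both rows are at `x₀`, the transport is along a constant step
  have hconst (m : ℤ) (h1 : l m = x₀) (h2 : l' m = x₀) (h3 : g m = y₀) : g' m = y₀ := by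
    rw [← h3]
    refine hp.step_unique (hgg' m) (Step.refl B _) ?_
    rw [hpg', hl', h2, hg, hl, h1]
  obtain ⟨⟨a, ha⟩, ⟨b, hb⟩⟩ := l.exists_stable
  obtain ⟨⟨a', ha'⟩, ⟨b', hb'⟩⟩ := l'.exists_stable
  obtain ⟨⟨c, hc⟩, ⟨d, hd⟩⟩ := g.exists_stable
  exact ⟨Loop.ofStep g' horiz
    ⟨min a (min a' c), fun m hm => hconst m (ha m (by lia)) (ha' m (by lia)) (hc m (by lia))⟩
    ⟨max b (max b' d), fun m hm => hconst m (hb m (by lia)) (hb' m (by lia)) (hd m (by lia))⟩,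
    hpg'⟩

/-- Homotopy lifting: whether a loop lifts to a loop at `y₀` depends only on its class. -/
theorem IsCovering.lift_of_homotopic {p : Hom B A} (hp : IsCovering p) {x₀ : X} {y₀ : Y}
    {ω ω' : Loop A x₀} (h : ω.Homotopic ω') (hω : LiftsToLoop p y₀ ω) : LiftsToLoop p y₀ ω' := by
  obtain ⟨H, ⟨a, ha⟩, ⟨b, hb⟩, hl⟩ := h
  have key : ∀ n, a ≤ n → LiftsToLoop p y₀ fun m => H (m, n) := by
    intro n hn
    induction n, hn using Int.leInduction with
    | base => simpa only [ha a le_rfl] using hω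
    | succ n hn ih => exact hp.liftsToLoop_succ H n (hl n) (hl (n + 1)) ih
  simpa only [hb _ (le_max_right a b)] using key (max a b) (le_max_left a b)

/-! ### The graph of the lift -/

/-- Some path in `Z` from `z₀` to `z` has an image under `f` which lifts along `p` to a path from
`y₀` to `y`. Paths are encoded as sequences of steps together with bounds `a` and `b` beyond which
they are constant. -/
def JointlyReachable (p : Hom B A) (f : Hom C A) (z₀ : Z) (y₀ : Y) (z : Z) (y : Y) : Prop :=
  ∃ (ω : ℤ → Z) (g : ℤ → Y) (a b : ℤ), (∀ n, C.Step (ω n) (ω (n + 1))) ∧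
    (∀ n, B.Step (g n) (g (n + 1))) ∧ (∀ n, p (g n) = f (ω n)) ∧
    (∀ n ≤ a, ω n = z₀ ∧ g n = y₀) ∧ ∀ n, b ≤ n → ω n = z ∧ g n = y

section JointlyReachable

variable {p : Hom B A} {f : Hom C A} {z₀ z z' : Z} {y₀ y y' : Y}

theorem JointlyReachable.base (h : p y₀ = f z₀) : JointlyReachable p f z₀ y₀ z₀ y₀ :=
  ⟨fun _ => z₀, fun _ => y₀, 0, 0, fun _ => Step.refl C _, fun _ => Step.refl B _, fun _ => h,
    fun _ _ => ⟨rfl, rfl⟩, fun _ _ => ⟨rfl, rfl⟩⟩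

theorem JointlyReachable.map_eq (h : JointlyReachable p f z₀ y₀ z y) : p y = f z := by
  obtain ⟨ω, g, a, b, -, -, hpf, -, hb⟩ := h
  rw [← (hb b le_rfl).1, ← (hb b le_rfl).2, hpf]

theorem JointlyReachable.step (h : JointlyReachable p f z₀ y₀ z y) (hz : C.Step z z')
    (hy : B.Step y y') (h' : p y' = f z') : JointlyReachable p f z₀ y₀ z' y' := by
  obtain ⟨ω, g, a, b, hω, hg, hpf, ha, hb⟩ := h
  refine ⟨fun n => if n ≤ b then ω n else z', fun n => if n ≤ b then g n else y', min a b, b + 1,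
    fun n => ?_, fun n => ?_, fun n => ?_, fun n hn => ?_, fun n hn => ?_⟩
  · rcases lt_trichotomy n b with hn | rfl | hn
    · simpa [hn.le, Int.add_one_le_iff.2 hn] using hω n
    · simpa [(hb n le_rfl).1] using hz
    · simpa [hn.not_ge, show ¬ n + 1 ≤ b by lia] using Step.refl C z'
  · rcases lt_trichotomy n b with hn | rfl | hn
    · simpa [hn.le, Int.add_one_le_iff.2 hn] using hg n
    · simpa [(hb n le_rfl).2] using hy
    · simpa [hn.not_ge, show ¬ n + 1 ≤ b by lia] using Step.refl B y'
  · by_cases hn : n ≤ b <;> simp [hn, hpf, h']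
  · simpa [show n ≤ b by lia] using ha n (by lia)
  · simp [show ¬ n ≤ b by lia]

theorem IsCovering.exists_jointlyReachable (hp : IsCovering p) (h₀ : p y₀ = f z₀)
    (hC : C.PathConnected) (z : Z) : ∃ y, JointlyReachable p f z₀ y₀ z y := by
  obtain ⟨ω, hi, ht⟩ := hC z₀ z
  obtain ⟨a, ha⟩ := (Path.init_eq_iff _ _).1 hi
  obtain ⟨b, hb⟩ := (Path.term_eq_iff _ _).1 ht
  have key : ∀ n, a ≤ n → ∃ y, JointlyReachable p f z₀ y₀ (ω n) y := by
    intro n hn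
    induction n, hn using Int.leInduction with
    | base => exact ⟨y₀, by rw [ha a le_rfl]; exact .base h₀⟩
    | succ n hn ih =>
      obtain ⟨y, hy⟩ := ih
      have hs : C.Step (ω n) (ω (n + 1)) := (line_step n).map ω.toHom
      have hs' := hs.map f
      rw [← hy.map_eq] at hs'
      obtain ⟨y', hyy', hpy'⟩ := hp.exists_step hs'
      exact ⟨y', hy.step hs hyy' hpy'⟩
  simpa only [hb _ (le_max_right a b)] using key (max a b) (le_max_left a b)

theorem IsCovering.jointlyReachable_unique (hp : IsCovering p)
    (hloop : ∀ l : Loop C z₀, LiftsToLoop p y₀ fun n => f (l n))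
    (h : JointlyReachable p f z₀ y₀ z y) (h' : JointlyReachable p f z₀ y₀ z y') : y = y' := by
  obtain ⟨ω, g, a, b, hω, hg, hpf, ha, hb⟩ := h
  obtain ⟨ω', g', a', b', hω', hg', hpf', ha', hb'⟩ := h'
  -- follow `ω` up to time `c`, then run `ω'` backwards from time `c`
  let c := max b b'
  let l : ℤ → Z := fun n => if n ≤ c then ω n else ω' (2 * c - n)
  have hle (n : ℤ) (hn : n ≤ c) : l n = ω n := if_pos hn
  have hge (n : ℤ) (hn : c ≤ n) : l n = ω' (2 * c - n) := by
    rcases hn.eq_or_lt with rfl | hn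
    · rw [hle _ le_rfl, (hb _ (by lia)).1, (hb' _ (by lia)).1]
    · exact if_neg hn.not_ge
  have hstep (n : ℤ) : C.Step (l n) (l (n + 1)) := by
    rcases lt_or_ge n c with hn | hn
    · rw [hle n hn.le, hle (n + 1) hn]
      exact hω n
    · rw [hge n hn, hge (n + 1) (by lia)]
      have := (hω' (2 * c - (n + 1))).symm
      rwa [show 2 * c - (n + 1) + 1 = 2 * c - n by ring] at this
  obtain ⟨k, hk⟩ := hloop (Loop.ofStep l hstep
    ⟨min a c, fun n hn => by rw [hle n (by lia)]; exact (ha n (by lia)).1⟩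
    ⟨max (2 * c - a') c, fun n hn => by rw [hge n (by lia)]; exact (ha' _ (by lia)).1⟩)
  replace hk (n : ℤ) : p (k n) = f (l n) := hk n
  have hks (n : ℤ) : B.Step (k n) (k (n + 1)) := (line_step n).map k.toHom
  obtain ⟨⟨s, hs⟩, ⟨t, ht⟩⟩ := k.exists_stable
  have h1 : g c = k c := by
    refine hp.lift_unique (a := min c (min a s)) (by lia) (fun n _ => hg n) (fun n _ => hks n)
      (fun n hn => ?_) ?_
    · rw [hpf, hk, hle n hn]
    · rw [(ha _ (by lia)).2, hs _ (by lia)]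
  have h2 : g' c = k (2 * c - c) := by
    refine hp.lift_unique (h := fun n => k (2 * c - n)) (a := min c (min a' (2 * c - t))) (by lia)
      (fun n _ => hg' n) (fun n _ => ?_) (fun n hn => ?_) ?_
    · have := (hks (2 * c - (n + 1))).symm
      rwa [show 2 * c - (n + 1) + 1 = 2 * c - n by ring] at this
    · rw [hpf', hk, hge _ (by lia), sub_sub_cancel]
    · rw [(ha' _ (by lia)).2, ht _ (by lia)]
  rw [← (hb c (by lia)).2, ← (hb' c (by lia)).2, h1, h2]
  congr 1
  ring

/-- If every loop at the base point lifts to a loop, then `f` lifts along the covering `p`. -/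
theorem IsCovering.exists_lift (hp : IsCovering p) (h₀ : p y₀ = f z₀) (hC : C.PathConnected)
    (hloop : ∀ l : Loop C z₀, LiftsToLoop p y₀ fun n => f (l n)) :
    ∃ F : Hom C B, (∀ z, p (F z) = f z) ∧ F z₀ = y₀ := by
  choose F hF using hp.exists_jointlyReachable h₀ hC
  refine ⟨⟨F, fun {n} z hz => ?_⟩, fun z => (hF z).map_eq,
    hp.jointlyReachable_unique hloop (hF z₀) (.base h₀)⟩
  refine hp.isFrame_of_step ?_ fun i => ?_
  · simpa only [(hF _).map_eq] using f.map_frame z hz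
  · have hs := (hz.step 0 i).map f
    rw [← (hF _).map_eq] at hs
    obtain ⟨y, hy, hpy⟩ := hp.exists_step hs
    rwa [hp.jointlyReachable_unique hloop (hF (z i)) ((hF (z 0)).step (hz.step 0 i) hy hpy)]

end JointlyReachable

theorem Loop.Homotopic.of_eq {x : X} {ω ω' : Loop A x} (h : ∀ n, ω n = ω' n) : ω.Homotopic ω' := by
  obtain ⟨H, hl, ⟨k, hk⟩, hH⟩ := Loop.Homotopic.refl ω
  exact ⟨H, hl, ⟨k, fun n hn m => (hk n hn m).trans (h m)⟩, hH⟩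

end GlobalAction

theorem theorem4p7 {X : Type*} {Y : Type*} {Z : Type*}
    (A : GlobalAction X) (B : GlobalAction Y) (C : GlobalAction Z)
    (x₀ : X) (y₀ : Y) (z₀ : Z)
    (p : GlobalAction.Hom B A) (hp : GlobalAction.IsCovering p) (hp₀ : p y₀ = x₀)
    (f : GlobalAction.Hom C A) (hf₀ : f z₀ = x₀) (hC : C.PathConnected) :
    (∃ F : GlobalAction.Hom C B, (∀ z, p (F z) = f z) ∧ F z₀ = y₀) ↔
      Set.range (GlobalAction.Pi1.map f hf₀) ⊆ Set.range (GlobalAction.Pi1.map p hp₀) := by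
  constructor
  · rintro ⟨F, hF, hF₀⟩ _ ⟨q, rfl⟩
    induction q using Quotient.inductionOn with | _ ω => ?_
    exact ⟨.map F hF₀ (Quotient.mk _ ω), Quotient.sound (.of_eq fun n => hF (ω n))⟩
  · intro h
    refine hp.exists_lift (hp₀.trans hf₀.symm) hC fun l => ?_
    obtain ⟨q, hq⟩ := h ⟨Quotient.mk _ l, rfl⟩
    induction q using Quotient.inductionOn with | _ k => ?_
    exact hp.lift_of_homotopic (Quotient.exact hq) ⟨k, fun _ => rfl⟩
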